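/- Let $(X,\mathcal B,\mu)$ be a standard Borel space with a nonatomic $\sigma$-finite measure, and let $T:X\to X$ be a measure-preserving transformation that is invertible modulo $\mu$ (equalities and disjointness of sets are understood modulo $\mu$). A \emph{column} of height $h\ge 1$ is a collection of pairwise disjoint measurable sets (levels) $B, TB,\dots,T^{h-1}B$ with base $B$. Suppose that $T$ is a rank-one transformation, given by a cutting-and-stacking construction with a bounded number of cuts. That is, there are columns $C_n=\{B_n,TB_n,\dots,T^{h_n-1}B_n\}$ $(n\ge 0)$ and integers $r_n\ge 2$ and $s_{n,k}\ge 0$ $(0\le k<r_n)$ such that 1. $h_0=1$ and $I:=B_0$ satisfies $0<\mu(I)<\infty$; 2. for every $n$, $h_{n+1}=\sum_{k=0}^{r_n-1}(h_n+s_{n,k})$ and $B_n=\bigcup_{i=0}^{r_n-1}T^{\,d_{n,i}}B_{n+1}$ with $d_{n,i}=\sum_{k=0}^{i-1}(h_n+s_{n,k})$ (the column $C_n$ is cut into $r_n$ subcolumns of equal width, $s_{n,k}$ spacers are placed above the $k$-th subcolumn, and each subcolumn with its spacers is stacked under the next); 3. for every measurable $A\subset X$ with $\mu(A)<\infty$ and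 every $\varepsilon>0$ there is an $N$ such that for every $n\ge N$ some union $B'$ of levels of $C_n$ satisfies $\mu(A\,\triangle\,B')<\varepsilon$; 4. $\sup_n r_n<\infty$. Then $T$ is weakly rationally ergodic, with the set $I$ as a witness: $0<\mu(I)<\infty$, $\mu\bigl(X\setminus\bigcup_{i\ge 0}T^iI\bigr)=0$, and for all measurable $A,B\subset I$, $$\frac{1}{a_n(I)}\sum_{k=0}^{n-1}\mu(A\cap T^kB)\longrightarrow\mu(A)\mu(B)\quad\text{as } n\to\infty \text{ (along all } n\in\mathbb N),\qquad a_n(I)=\sum_{k=0}^{n-1}\frac{\mu(I\cap T^kI)}{\mu(I)^2}.$$ -/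

import Mathlib

open MeasureTheory Filter Topology

/-- A measure-preserving transformation of `(X, μ)` that is invertible modulo `μ`. -/
structure InvertibleMP {X : Type*} [MeasurableSpace X] (μ : Measure X) where
  /-- the transformation `T` -/
  toFun : X → X
  /-- an inverse of `T` modulo `μ` -/
  invFun : X → X
  measurePreserving : MeasurePreserving toFun μ μ
  measurable_invFun : Measurable invFun
  left_inv : ∀ᵐ x ∂μ, invFun (toFun x) = x
  right_inv : ∀ᵐ x ∂μ, toFun (invFun x) = x

/-- A genuine bimeasurable measure-preserving bijection is invertible modulo `μ`. -/
def InvertibleMP.ofEquiv {X : Type*} [MeasurableSpace X] {μ : Measure X} (e : X ≃ᵐ X)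
    (he : MeasurePreserving e μ μ) : InvertibleMP μ where
  toFun := e
  invFun := e.symm
  measurePreserving := he
  measurable_invFun := e.symm.measurable
  left_inv := Eventually.of_forall fun x => e.symm_apply_apply x
  right_inv := Eventually.of_forall fun x => e.apply_symm_apply x

/-- The image `T ^ k (A)` for `k ≥ 0`. It is written as the preimage of `A` under the `k`-th iterate
of the inverse, which is the correct notion for a `T` that is only invertible modulo `μ` (the
pointwise image of a null set need not be null). -/
def InvertibleMP.image {X : Type*} [MeasurableSpace X] {μ : Measure X} (T : InvertibleMP μ)
    (k : ℕ) (A : Set X) : Set X :=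
  T.invFun^[k] ⁻¹' A

/-- For a genuine bijection, `T.image k A` is the pointwise image of `A` under `T ^ k`. -/
theorem InvertibleMP.image_ofEquiv {X : Type*} [MeasurableSpace X] {μ : Measure X} (e : X ≃ᵐ X)
    (he : MeasurePreserving e μ μ) (k : ℕ) (A : Set X) :
    (InvertibleMP.ofEquiv e he).image k A = e^[k] '' A := by
  have h1 : Function.LeftInverse (e.symm^[k]) (e^[k]) :=
    Function.LeftInverse.iterate e.symm_apply_apply k
  have h2 : Function.RightInverse (e.symm^[k]) (e^[k]) :=
    Function.RightInverse.iterate e.apply_symm_apply k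
  exact (congrFun (Set.image_eq_preimage_of_inverse h1 h2) A).symm

/-! ### Weak rational ergodicity -/

/-- The intrinsic weight `u_k(F) = μ(F ∩ T^k F) / μ(F)^2`. -/
noncomputable def InvertibleMP.weight {X : Type*} [MeasurableSpace X] {μ : Measure X}
    (T : InvertibleMP μ) (F : Set X) (k : ℕ) : ℝ :=
  μ.real (F ∩ T.image k F) / μ.real F ^ 2

/-- `a_n(F) = ∑_{k < n} u_k(F)`. -/
noncomputable def InvertibleMP.weightSum {X : Type*} [MeasurableSpace X] {μ : Measure X}
    (T : InvertibleMP μ) (F : Set X) (n : ℕ) : ℝ :=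
  ∑ k ∈ Finset.range n, T.weight F k

/-- `F` sweeps out: `μ (X \ ⋃_{i ≥ 0} T^i F) = 0`. -/
def InvertibleMP.SweepsOut {X : Type*} [MeasurableSpace X] {μ : Measure X}
    (T : InvertibleMP μ) (F : Set X) : Prop :=
  μ (⋃ i : ℕ, T.image i F)ᶜ = 0

/-- `T` is weakly rationally ergodic with witness `F`: the set `F` has positive finite measure, sweeps
out, and `a_n(F)⁻¹ ∑_{k < n} μ(A ∩ T^k B) → μ(A) μ(B)` for all measurable `A, B ⊆ F`. -/
structure InvertibleMP.IsWeaklyRationallyErgodicOn {X : Type*} [MeasurableSpace X]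
    {μ : Measure X} (T : InvertibleMP μ) (F : Set X) : Prop where
  measurableSet : MeasurableSet F
  measure_pos : 0 < μ F
  measure_lt_top : μ F < ⊤
  sweepsOut : T.SweepsOut F
  tendsto : ∀ A B : Set X, MeasurableSet A → MeasurableSet B → A ⊆ F → B ⊆ F →
    Tendsto
      (fun n : ℕ => 1 / T.weightSum F n * ∑ k ∈ Finset.range n, μ.real (A ∩ T.image k B))
      atTop (𝓝 (μ.real A * μ.real B))

/-- `T` is weakly rationally ergodic. -/
def InvertibleMP.IsWeaklyRationallyErgodic {X : Type*} [MeasurableSpace X] {μ : Measure X}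
    (T : InvertibleMP μ) : Prop :=
  ∃ F : Set X, T.IsWeaklyRationallyErgodicOn F

/-! ### Rank-one transformations -/

/-- A Rokhlin column for `T`: pairwise disjoint (modulo `μ`) measurable levels
`B, T B, …, T^(h-1) B`. -/
structure RokhlinColumn {X : Type*} [MeasurableSpace X] {μ : Measure X} (T : InvertibleMP μ) where
  /-- the bottom level `B` -/
  base : Set X
  /-- the number `h` of levels -/
  height : ℕ
  measurableSet_base : MeasurableSet base
  height_pos : 0 < height
  disjoint : ∀ i j : ℕ, i < j → j < height → AEDisjoint μ (T.image i base) (T.image j base)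

/-- The columns `C n` approximate every measurable set of finite measure: for all `A` and `ε` there
is `N` such that for `n ≥ N` some union of levels of `C n` is within `ε` of `A`. -/
def ConvergesToPointPartition {X : Type*} [MeasurableSpace X] {μ : Measure X} {T : InvertibleMP μ}
    (C : ℕ → RokhlinColumn T) : Prop :=
  ∀ A : Set X, MeasurableSet A → μ A < ⊤ → ∀ ε : ℝ, 0 < ε → ∃ N : ℕ, ∀ n ≥ N,
    ∃ E : Finset ℕ, (∀ i ∈ E, i < (C n).height) ∧
      μ (symmDiff A (⋃ i ∈ E, T.image i (C n).base)) < ENNReal.ofReal ε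

/-- `T` is rank-one. -/
def InvertibleMP.IsRankOne {X : Type*} [MeasurableSpace X] {μ : Measure X}
    (T : InvertibleMP μ) : Prop :=
  ∃ C : ℕ → RokhlinColumn T, ConvergesToPointPartition C

/-- A cutting-and-stacking construction of the rank-one transformation `T`. The column `C_0` is a
single set of positive finite measure. The column `C_n` is cut into `r_n = cuts n ≥ 2` subcolumns of
equal width, `s_{n,k} = spacers n k` spacers are put above the `k`-th subcolumn (`0 ≤ k < r_n`), and
`C_{n+1}` is the result of stacking each subcolumn with its spacers under the next one. Thus
`h_{n+1} = ∑_{k < r_n} (h_n + s_{n,k})`, and the base of the `i`-th subcolumn of `C_n` is the level of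
`C_{n+1}` of height `∑_{k < i} (h_n + s_{n,k})`. -/
structure CuttingAndStacking {X : Type*} [MeasurableSpace X] {μ : Measure X}
    (T : InvertibleMP μ) where
  /-- the columns `C_n` -/
  column : ℕ → RokhlinColumn T
  /-- the numbers `r_n` of subcolumns -/
  cuts : ℕ → ℕ
  /-- the numbers `s_{n,k}` of spacers; only the values with `k < r_n` matter -/
  spacers : ℕ → ℕ → ℕ
  height_zero : (column 0).height = 1
  measure_base_zero_pos : 0 < μ (column 0).base
  measure_base_zero_lt_top : μ (column 0).base < ⊤
  two_le_cuts : ∀ n, 2 ≤ cuts n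
  height_succ : ∀ n, (column (n + 1)).height =
    ∑ k ∈ Finset.range (cuts n), ((column n).height + spacers n k)
  base_eq : ∀ n, (column n).base =ᵐ[μ]
    (⋃ i ∈ Finset.range (cuts n),
      T.image (∑ k ∈ Finset.range i, ((column n).height + spacers n k)) (column (n + 1)).base : Set X)
  converges : ConvergesToPointPartition column

/-- A transformation with a cutting-and-stacking construction is rank-one. -/
theorem CuttingAndStacking.isRankOne {X : Type*} [MeasurableSpace X] {μ : Measure X}
    {T : InvertibleMP μ} (C : CuttingAndStacking T) : T.IsRankOne :=
  ⟨C.column, C.converges⟩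

/-- The level `I` of the column `C_0`. -/
def CuttingAndStacking.initialLevel {X : Type*} [MeasurableSpace X] {μ : Measure X}
    {T : InvertibleMP μ} (C : CuttingAndStacking T) : Set X :=
  (C.column 0).base

/-- The construction has a bounded number of cuts: `sup_n r_n < ∞`. -/
def CuttingAndStacking.HasBoundedCuts {X : Type*} [MeasurableSpace X] {μ : Measure X}
    {T : InvertibleMP μ} (C : CuttingAndStacking T) : Prop :=
  ∃ K : ℕ, ∀ n, C.cuts n ≤ K

/-! Write S_n(A,B) = ∑_{k<n} μ(A ∩ T^k B), which is `corr`. Since a_n(I) = S_n(I,I)/μ(I)², the claim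
is that S_n(A,B)/S_n(I,I) → μ(A)μ(B)/μ(I)² for A, B ⊆ I.

Fix a column with base B. By telescoping, S_n(T^i B, T^j B) differs from S_n(B,B) by at most
(i+j)μ(B), whatever n is (`abs_corr_image_image_sub_corr_le`). As S_n(I,I) → ∞, all pairs of levels
asymptotically get the same share of S_n(I,I), and the limit for unions of levels is obtained by
counting levels (`RokhlinColumn.tendsto_corr_div_corr`).

General A, B are approximated by unions of levels inside I. The error is controlled uniformly in n
by S_n(A,I), S_n(I,A) ≤ c μ(A) S_n(I,I) with c = 2K/μ(I) (`corr_le_mul_corr`), where K bounds the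
numbers of cuts. Indeed, let D_m index the levels of C_m that make up I, and let h_m ≤ n < h_{m+1}.
Until time h_{m+1} each level of C_{m+1} is visited at most once, so both sums are at most |D_{m+1}|
μ(A). From time h_m on, each level of C_m in I has reached every higher one, so S_n(I,I) ≥ |D_m|
μ(I)/2. Finally |D_{m+1}| = r_m |D_m| ≤ K |D_m|. -/

/-! ### Additivity of the measure along almost everywhere disjoint unions -/

theorem measureReal_inter_of_ae_eq_biUnion {X ι : Type*} [MeasurableSpace X] {μ : Measure X}
    {A B : Set X} {E : Finset ι} {L : ι → Set X} (hA : A =ᵐ[μ] (⋃ i ∈ E, L i : Set X))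
    (hB : MeasurableSet B) (hBfin : μ B ≠ ⊤) (hL : ∀ i ∈ E, MeasurableSet (L i))
    (hd : (E : Set ι).Pairwise fun i j => AEDisjoint μ (L i) (L j)) :
    μ.real (A ∩ B) = ∑ i ∈ E, μ.real (L i ∩ B) := by
  rw [measureReal_congr (hA.inter (ae_eq_refl B)), Set.iUnion₂_inter]
  refine measureReal_biUnion_finset₀ (fun i hi j hj hij => ?_)
    (fun i hi => ((hL i hi).inter hB).nullMeasurableSet)
    (fun i _ => measure_ne_top_of_subset Set.inter_subset_right hBfin)
  exact (hd hi hj hij).mono Set.inter_subset_left Set.inter_subset_left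

theorem measureReal_of_ae_eq_biUnion {X ι : Type*} [MeasurableSpace X] {μ : Measure X}
    {A : Set X} {E : Finset ι} {L : ι → Set X} (hA : A =ᵐ[μ] (⋃ i ∈ E, L i : Set X))
    (hL : ∀ i ∈ E, MeasurableSet (L i)) (hfin : ∀ i ∈ E, μ (L i) ≠ ⊤)
    (hd : (E : Set ι).Pairwise fun i j => AEDisjoint μ (L i) (L j)) :
    μ.real A = ∑ i ∈ E, μ.real (L i) := by
  rw [measureReal_congr hA]
  exact measureReal_biUnion_finset₀ hd (fun i hi => (hL i hi).nullMeasurableSet) hfin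

theorem sum_measureReal_inter_le {X ι : Type*} [MeasurableSpace X] {μ : Measure X}
    {A : Set X} (E : Finset ι) {L : ι → Set X} (hA : MeasurableSet A) (hAfin : μ A ≠ ⊤)
    (hL : ∀ i ∈ E, MeasurableSet (L i))
    (hd : (E : Set ι).Pairwise fun i j => AEDisjoint μ (L i) (L j)) :
    ∑ i ∈ E, μ.real (A ∩ L i) ≤ μ.real A := by
  have h := measureReal_inter_of_ae_eq_biUnion (ae_eq_refl (⋃ i ∈ E, L i)) hA hAfin hL hd
  simp only [Set.inter_comm A]
  rw [← h]
  exact measureReal_mono Set.inter_subset_right hAfin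

/-- The pairs `i ≤ j` make up at least half of a square. -/
theorem Finset.sq_card_le_two_mul_card_filter_le (D : Finset ℕ) :
    D.card ^ 2 ≤ 2 * ((D ×ˢ D).filter fun p => p.1 ≤ p.2).card := by
  have h1 : ((D ×ˢ D).filter fun p => ¬ p.1 ≤ p.2).card ≤
      ((D ×ˢ D).filter fun p => p.1 ≤ p.2).card := by
    -- Swapping the coordinates injects the pairs with i > j into those with i ≤ j.
    refine Finset.card_le_card_of_injOn Prod.swap (fun p hp => ?_) Prod.swap_injective.injOn
    simp only [Finset.coe_filter, Finset.mem_product, Set.mem_ofPred_eq, Prod.fst_swap,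
      Prod.snd_swap] at hp ⊢
    exact ⟨hp.1.symm, by omega⟩
  have h2 := Finset.card_filter_add_card_filter_not (s := D ×ˢ D) (fun p => p.1 ≤ p.2)
  rw [Finset.card_product] at h2
  nlinarith

/-! ### Images modulo null sets and correlation sums. -/

namespace InvertibleMP

variable {X : Type*} [MeasurableSpace X] {μ : Measure X} (T : InvertibleMP μ)

/-- Images are preimages under `invFun`, so all invariance of images rests on this. Pulling `invFun
⁻¹' A` back by T gives A up to a null set. -/
theorem measurePreserving_invFun : MeasurePreserving T.invFun μ μ := by
  refine ⟨T.measurable_invFun, Measure.ext fun A hA => ?_⟩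
  rw [Measure.map_apply T.measurable_invFun hA,
    ← T.measurePreserving.measure_preimage (T.measurable_invFun hA).nullMeasurableSet]
  refine measure_congr ?_
  filter_upwards [T.left_inv] with x hx
  exact congrArg A hx

theorem image_zero (A : Set X) : T.image 0 A = A := rfl

theorem image_add (i j : ℕ) (A : Set X) : T.image (i + j) A = T.image i (T.image j A) := by
  rw [image, add_comm, Function.iterate_add, Set.preimage_comp]; rfl

theorem image_inter (k : ℕ) (A B : Set X) : T.image k (A ∩ B) = T.image k A ∩ T.image k B := rfl

theorem image_mono (k : ℕ) {A B : Set X} (h : A ⊆ B) : T.image k A ⊆ T.image k B :=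
  Set.preimage_mono h

theorem image_iUnion₂ {ι : Type*} {κ : ι → Sort*} (k : ℕ) (A : ∀ i, κ i → Set X) :
    T.image k (⋃ (i) (j), A i j) = ⋃ (i) (j), T.image k (A i j) :=
  Set.preimage_iUnion₂

theorem measurableSet_image (k : ℕ) {A : Set X} (hA : MeasurableSet A) :
    MeasurableSet (T.image k A) :=
  T.measurable_invFun.iterate k hA

theorem image_congr_ae (k : ℕ) {A B : Set X} (h : A =ᵐ[μ] B) : T.image k A =ᵐ[μ] T.image k B :=
  (T.measurePreserving_invFun.iterate k).quasiMeasurePreserving.preimage_ae_eq h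

theorem image_mono_ae (k : ℕ) {A B : Set X} (h : A ≤ᵐ[μ] B) : T.image k A ≤ᵐ[μ] T.image k B :=
  (T.measurePreserving_invFun.iterate k).quasiMeasurePreserving.preimage_mono_ae h

theorem measure_image (k : ℕ) {A : Set X} (hA : MeasurableSet A) : μ (T.image k A) = μ A :=
  (T.measurePreserving_invFun.iterate k).measure_preimage hA.nullMeasurableSet

theorem measureReal_image (k : ℕ) {A : Set X} (hA : MeasurableSet A) :
    μ.real (T.image k A) = μ.real A := by
  rw [Measure.real, T.measure_image k hA, Measure.real]

theorem aedisjoint_image (k : ℕ) {A B : Set X} (h : AEDisjoint μ A B) :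
    AEDisjoint μ (T.image k A) (T.image k B) :=
  (T.measurePreserving_invFun.iterate k).quasiMeasurePreserving.preimage_null h

/-- `∑_{k < n} μ(A ∩ T^k B)`. -/
noncomputable def corr (A B : Set X) (n : ℕ) : ℝ :=
  ∑ k ∈ Finset.range n, μ.real (A ∩ T.image k B)

theorem corr_nonneg (A B : Set X) (n : ℕ) : 0 ≤ T.corr A B n :=
  Finset.sum_nonneg fun _ _ => measureReal_nonneg

theorem weightSum_eq (F : Set X) (n : ℕ) : T.weightSum F n = T.corr F F n / μ.real F ^ 2 := by
  simp only [weightSum, weight, corr, Finset.sum_div]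

theorem corr_eq_sum_left {ι : Type*} {A B : Set X} {E : Finset ι} {L : ι → Set X}
    (hA : A =ᵐ[μ] (⋃ i ∈ E, L i : Set X)) (hB : MeasurableSet B) (hBfin : μ B ≠ ⊤)
    (hL : ∀ i ∈ E, MeasurableSet (L i))
    (hd : (E : Set ι).Pairwise fun i j => AEDisjoint μ (L i) (L j)) (n : ℕ) :
    T.corr A B n = ∑ i ∈ E, T.corr (L i) B n := by
  simp only [corr]
  rw [Finset.sum_comm]
  exact Finset.sum_congr rfl fun k _ => measureReal_inter_of_ae_eq_biUnion hA
    (T.measurableSet_image k hB) ((T.measure_image k hB).trans_ne hBfin) hL hd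

theorem corr_eq_sum_right {ι : Type*} {A B : Set X} {E : Finset ι} {L : ι → Set X}
    (hB : B =ᵐ[μ] (⋃ i ∈ E, L i : Set X)) (hA : MeasurableSet A) (hAfin : μ A ≠ ⊤)
    (hL : ∀ i ∈ E, MeasurableSet (L i))
    (hd : (E : Set ι).Pairwise fun i j => AEDisjoint μ (L i) (L j)) (n : ℕ) :
    T.corr A B n = ∑ i ∈ E, T.corr A (L i) n := by
  simp only [corr]
  rw [Finset.sum_comm]
  refine Finset.sum_congr rfl fun k _ => ?_
  simp only [Set.inter_comm A]
  refine measureReal_inter_of_ae_eq_biUnion (L := fun i => T.image k (L i)) ?_ hA hAfin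
    (fun i hi => T.measurableSet_image k (hL i hi))
    (fun i hi j hj hij => T.aedisjoint_image k (hd hi hj hij))
  rw [← image_iUnion₂]
  exact T.image_congr_ae k hB

theorem corr_image_image (i : ℕ) {A B : Set X} (hA : MeasurableSet A) (hB : MeasurableSet B)
    (n : ℕ) : T.corr (T.image i A) (T.image i B) n = T.corr A B n := by
  refine Finset.sum_congr rfl fun k _ => ?_
  rw [← image_add, add_comm, image_add, ← image_inter,
    T.measureReal_image i (hA.inter (T.measurableSet_image k hB))]

/-- Shifting the second set changes the correlation sums only by a bounded amount. -/
theorem abs_corr_image_sub_corr_le (A : Set X) {B : Set X} (hB : MeasurableSet B)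
    (hBfin : μ B ≠ ⊤) (n j : ℕ) :
    |T.corr A (T.image j B) n - T.corr A B n| ≤ j * μ.real B := by
  induction j with
  | zero => simp [image_zero]
  | succ j ih =>
    have hle : ∀ k, μ.real (A ∩ T.image k (T.image j B)) ≤ μ.real B := fun k => by
      rw [← image_add]
      exact (measureReal_mono Set.inter_subset_right
        ((T.measure_image _ hB).trans_ne hBfin)).trans_eq (T.measureReal_image _ hB)
    -- One more shift of B replaces the index k by k + 1, so the difference telescopes to the two
    -- boundary terms.
    have hstep : T.corr A (T.image (j + 1) B) n - T.corr A (T.image j B) n =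
        μ.real (A ∩ T.image n (T.image j B)) - μ.real (A ∩ T.image 0 (T.image j B)) := by
      rw [← Finset.sum_range_sub (fun k => μ.real (A ∩ T.image k (T.image j B))),
        Finset.sum_sub_distrib, corr, corr]
      congr 1
      refine Finset.sum_congr rfl fun k _ => ?_
      rw [← image_add, ← image_add, add_assoc, add_comm 1 j]
    have habs : |T.corr A (T.image (j + 1) B) n - T.corr A (T.image j B) n| ≤ μ.real B := by
      rw [hstep]
      exact abs_sub_le_of_nonneg_of_le measureReal_nonneg (hle n) measureReal_nonneg (hle 0)
    calc _ ≤ _ := abs_sub_le _ (T.corr A (T.image j B) n) _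
      _ ≤ μ.real B + j * μ.real B := add_le_add habs ih
      _ = _ := by push_cast; ring

/-- Keep the first set equal to T^i B and shift the second one back from T^j B to B and forward from
B to T^i B. By invariance, S_n(T^i B, T^i B) = S_n(B,B). The bound does not depend on n. -/
theorem abs_corr_image_image_sub_corr_le {B : Set X} (hB : MeasurableSet B) (hBfin : μ B ≠ ⊤)
    (n i j : ℕ) :
    |T.corr (T.image i B) (T.image j B) n - T.corr B B n| ≤ (j + i) * μ.real B := by
  have h1 := T.abs_corr_image_sub_corr_le (T.image i B) hB hBfin n j
  have h2 := T.abs_corr_image_sub_corr_le (T.image i B) hB hBfin n i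
  rw [T.corr_image_image i hB hB] at h2
  rw [abs_le] at *
  constructor <;> linarith [h1.1, h1.2, h2.1, h2.2]

/-- Replacing two subsets of `I` changes the correlation sums at most by the correlation sums of
the symmetric differences. -/
theorem abs_corr_sub_corr_le {I A A' B B' : Set X} (hIfin : μ I ≠ ⊤)
    (hA : A ⊆ I) (hA' : A' ⊆ I) (hB : B ⊆ I) (hB' : B' ⊆ I) (hAm : MeasurableSet A)
    (hAm' : MeasurableSet A') (hBm : MeasurableSet B) (hBm' : MeasurableSet B') (n : ℕ) :
    |T.corr A B n - T.corr A' B' n| ≤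
      T.corr (symmDiff A A') I n + T.corr I (symmDiff B B') n := by
  simp only [corr]
  rw [← Finset.sum_sub_distrib, ← Finset.sum_add_distrib]
  refine (Finset.abs_sum_le_sum_abs _ _).trans (Finset.sum_le_sum fun k _ => ?_)
  have hfin : ∀ {S R : Set X}, S ⊆ I → μ (S ∩ R) ≠ ⊤ := fun h =>
    measure_ne_top_of_subset (Set.inter_subset_left.trans h) hIfin
  refine (abs_measureReal_sub_le_measureReal_symmDiff'
    (hAm.inter (T.measurableSet_image k hBm)).nullMeasurableSet
    (hAm'.inter (T.measurableSet_image k hBm')).nullMeasurableSet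
    (hfin hA) (hfin hA')).trans (le_trans (measureReal_mono ?_ ?_) (measureReal_union_le _ _))
  · intro x hx
    have hBI : x ∈ T.image k B → x ∈ T.image k I := fun h => T.image_mono k hB h
    have hBI' : x ∈ T.image k B' → x ∈ T.image k I := fun h => T.image_mono k hB' h
    have hAI : x ∈ A → x ∈ I := fun h => hA h
    have hAI' : x ∈ A' → x ∈ I := fun h => hA' h
    have hs : x ∈ T.image k (symmDiff B B') ↔
      (x ∈ T.image k B ∧ x ∉ T.image k B') ∨ (x ∈ T.image k B' ∧ x ∉ T.image k B) := Iff.rfl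
    simp only [Set.mem_symmDiff, Set.mem_inter_iff, Set.mem_union, hs] at hx ⊢
    tauto
  · refine measure_union_ne_top (hfin ?_) (hfin le_rfl)
    exact (Set.symmDiff_subset_union).trans (Set.union_subset hA hA')

end InvertibleMP

/-! ### Correlation sums of levels of a single column. -/

namespace RokhlinColumn

variable {X : Type*} [MeasurableSpace X] {μ : Measure X} {T : InvertibleMP μ}
  (c : RokhlinColumn T)

/-- The `i`-th level of a column. -/
def level (i : ℕ) : Set X := T.image i c.base

theorem measurableSet_level (i : ℕ) : MeasurableSet (c.level i) :=
  T.measurableSet_image i c.measurableSet_base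

theorem measureReal_level (i : ℕ) : μ.real (c.level i) = μ.real c.base :=
  T.measureReal_image i c.measurableSet_base

theorem measure_level (i : ℕ) : μ (c.level i) = μ c.base :=
  T.measure_image i c.measurableSet_base

theorem image_level (k i : ℕ) : T.image k (c.level i) = c.level (k + i) :=
  (T.image_add k i _).symm

theorem aedisjoint_level {i j : ℕ} (hij : i ≠ j) (hi : i < c.height) (hj : j < c.height) :
    AEDisjoint μ (c.level i) (c.level j) := by
  rcases lt_or_gt_of_ne hij with h | h
  · exact c.disjoint i j h hj
  · exact (c.disjoint j i h hi).symm

theorem pairwise_aedisjoint_level {E : Finset ℕ} (hE : ∀ i ∈ E, i < c.height) :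
    (E : Set ℕ).Pairwise fun i j => AEDisjoint μ (c.level i) (c.level j) :=
  fun i hi j hj hij => c.aedisjoint_level hij (hE i hi) (hE j hj)

variable {D : Finset ℕ} {I : Set X}

theorem measureReal_of_ae_eq_levels (hD : ∀ i ∈ D, i < c.height) (hfin : μ c.base ≠ ⊤)
    (hI : I =ᵐ[μ] (⋃ i ∈ D, c.level i : Set X)) : μ.real I = D.card * μ.real c.base := by
  rw [measureReal_of_ae_eq_biUnion hI (fun i _ => c.measurableSet_level i)
    (fun i _ => (c.measure_level i).trans_ne hfin) (c.pairwise_aedisjoint_level hD)]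
  simp [c.measureReal_level]

theorem corr_eq_sum_levels {E F : Finset ℕ} {A B : Set X} (hE : ∀ i ∈ E, i < c.height)
    (hF : ∀ i ∈ F, i < c.height) (hfin : μ c.base ≠ ⊤) (hBm : MeasurableSet B) (hBfin : μ B ≠ ⊤)
    (hA : A =ᵐ[μ] (⋃ i ∈ E, c.level i : Set X)) (hB : B =ᵐ[μ] (⋃ i ∈ F, c.level i : Set X))
    (n : ℕ) : T.corr A B n = ∑ i ∈ E, ∑ j ∈ F, T.corr (c.level i) (c.level j) n := by
  rw [T.corr_eq_sum_left hA hBm hBfin (fun i _ => c.measurableSet_level i)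
    (c.pairwise_aedisjoint_level hE)]
  exact Finset.sum_congr rfl fun i _ => T.corr_eq_sum_right hB (c.measurableSet_level i)
    ((c.measure_level i).trans_ne hfin) (fun i _ => c.measurableSet_level i)
    (c.pairwise_aedisjoint_level hF) n

/-- Up to time `c.height`, a point visits each level of the column at most once. -/
theorem corr_le_left (hD : ∀ i ∈ D, i < c.height) (hI : I =ᵐ[μ] (⋃ i ∈ D, c.level i : Set X))
    {A : Set X} (hA : MeasurableSet A) (hAfin : μ A ≠ ⊤) {n : ℕ} (hn : n ≤ c.height) :
    T.corr A I n ≤ D.card * μ.real A := by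
  rw [T.corr_eq_sum_right hI hA hAfin (fun i _ => c.measurableSet_level i)
    (c.pairwise_aedisjoint_level hD), ← nsmul_eq_mul]
  refine Finset.sum_le_card_nsmul _ _ _ fun d _ => ?_
  refine sum_measureReal_inter_le _ hA hAfin
    (fun k _ => T.measurableSet_image k (c.measurableSet_level d)) fun k hk l hl hkl => ?_
  simp only [Finset.coe_range, Set.mem_Iio] at hk hl
  -- The sets T^(k+d) B with k < n are the images under T^d of distinct levels of the column.
  rw [c.image_level, c.image_level, add_comm k, add_comm l, ← c.image_level, ← c.image_level]
  exact T.aedisjoint_image d (c.aedisjoint_level hkl (by omega) (by omega))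

theorem corr_le_right (hD : ∀ i ∈ D, i < c.height) (hI : I =ᵐ[μ] (⋃ i ∈ D, c.level i : Set X))
    {A : Set X} (hA : MeasurableSet A) (hAfin : μ A ≠ ⊤) {n : ℕ} (hn : n ≤ c.height) :
    T.corr I A n ≤ D.card * μ.real A := by
  rw [T.corr_eq_sum_left hI hA hAfin (fun i _ => c.measurableSet_level i)
    (c.pairwise_aedisjoint_level hD), ← nsmul_eq_mul]
  refine Finset.sum_le_card_nsmul _ _ _ fun d _ => ?_
  -- Applying T^(n-k) moves all the sets T^k A to the same set T^n A without using negative powers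
  -- of T.
  have hshift : ∀ k ∈ Finset.range n, μ.real (c.level d ∩ T.image k A) =
      μ.real (T.image n A ∩ T.image (n - k) (c.level d)) := fun k hk => by
    have hkn : n = (n - k) + k := by have := Finset.mem_range.1 hk; omega
    conv_rhs => enter [2, 1]; rw [hkn]
    rw [T.image_add, ← T.image_inter, T.measureReal_image _
      ((T.measurableSet_image k hA).inter (c.measurableSet_level d)), Set.inter_comm]
  rw [InvertibleMP.corr, Finset.sum_congr rfl hshift, ← T.measureReal_image n hA]
  refine sum_measureReal_inter_le _ (T.measurableSet_image n hA) ((T.measure_image n hA).trans_ne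
    hAfin) (fun k _ => T.measurableSet_image _ (c.measurableSet_level d)) fun k hk l hl hkl => ?_
  simp only [Finset.coe_range, Set.mem_Iio] at hk hl
  -- Here n - k runs through 1, …, n, and n may equal the height. Moving one more power of T into
  -- the common shift T^(d+1) leaves an index a < n, which is a genuine level.
  obtain ⟨a, ha⟩ : ∃ a, n - k = a + 1 := ⟨n - k - 1, by omega⟩
  obtain ⟨b, hb⟩ : ∃ b, n - l = b + 1 := ⟨n - l - 1, by omega⟩
  rw [ha, hb, c.image_level, c.image_level, show a + 1 + d = (d + 1) + a by ring,
    show b + 1 + d = (d + 1) + b by ring, ← c.image_level, ← c.image_level]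
  exact T.aedisjoint_image _ (c.aedisjoint_level (by omega) (by omega) (by omega))

/-- From time `c.height` on, every level of `I` has been carried to every higher level of `I`. -/
theorem card_sq_mul_le_corr (hD : ∀ i ∈ D, i < c.height)
    (hI : I =ᵐ[μ] (⋃ i ∈ D, c.level i : Set X)) (hIm : MeasurableSet I) (hfin : μ c.base ≠ ⊤)
    (hIfin : μ I ≠ ⊤) {n : ℕ} (hn : c.height ≤ n) :
    (D.card : ℝ) ^ 2 * μ.real c.base ≤ 2 * T.corr I I n := by
  rw [c.corr_eq_sum_levels hD hD hfin hIm hIfin hI hI, ← Finset.sum_product']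
  -- T^(j-i) carries level i onto level j, and j - i is smaller than the height, hence than n. So
  -- this single term already contributes the measure of a level.
  have hterm : ∀ p ∈ (D ×ˢ D).filter (fun p => p.1 ≤ p.2),
      μ.real c.base ≤ T.corr (c.level p.2) (c.level p.1) n := fun p hp => by
    simp only [Finset.mem_filter, Finset.mem_product] at hp
    have hmem : p.2 - p.1 ∈ Finset.range n := by
      have := hD _ hp.1.2
      rw [Finset.mem_range]; omega
    refine le_trans (le_of_eq ?_) (Finset.single_le_sum
      (f := fun k => μ.real (c.level p.2 ∩ T.image k (c.level p.1)))
      (fun _ _ => measureReal_nonneg) hmem)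
    rw [c.image_level, Nat.sub_add_cancel hp.2, Set.inter_self, c.measureReal_level]
  have hcard : (D.card : ℝ) ^ 2 ≤ 2 * ((D ×ˢ D).filter fun p => p.1 ≤ p.2).card := by
    exact_mod_cast D.sq_card_le_two_mul_card_filter_le
  have hsum := Finset.card_nsmul_le_sum _ _ _ hterm
  rw [nsmul_eq_mul] at hsum
  have hsub : ∑ p ∈ (D ×ˢ D).filter (fun p => p.1 ≤ p.2), T.corr (c.level p.2) (c.level p.1) n ≤
      ∑ p ∈ D ×ˢ D, T.corr (c.level p.2) (c.level p.1) n :=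
    Finset.sum_le_sum_of_subset_of_nonneg (Finset.filter_subset _ _)
      fun _ _ _ => T.corr_nonneg _ _ _
  have hswap : ∑ p ∈ D ×ˢ D, T.corr (c.level p.2) (c.level p.1) n =
      ∑ p ∈ D ×ˢ D, T.corr (c.level p.1) (c.level p.2) n := by
    rw [Finset.sum_product_right, Finset.sum_product]
  have hb : 0 ≤ μ.real c.base := measureReal_nonneg
  nlinarith [mul_le_mul_of_nonneg_right hcard hb]

/-- The correlation sums of unions of levels are asymptotically proportional to the numbers of
levels. -/
theorem tendsto_corr_div_corr (hD : ∀ i ∈ D, i < c.height) (hDne : D.Nonempty)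
    (hI : I =ᵐ[μ] (⋃ i ∈ D, c.level i : Set X)) (hIm : MeasurableSet I) (hfin : μ c.base ≠ ⊤)
    (hIfin : μ I ≠ ⊤) (hlim : Tendsto (T.corr I I) atTop atTop)
    {E F : Finset ℕ} {A B : Set X} (hE : ∀ i ∈ E, i < c.height) (hF : ∀ i ∈ F, i < c.height)
    (hBm : MeasurableSet B) (hBfin : μ B ≠ ⊤)
    (hA : A =ᵐ[μ] (⋃ i ∈ E, c.level i : Set X)) (hB : B =ᵐ[μ] (⋃ i ∈ F, c.level i : Set X)) :
    Tendsto (fun n => T.corr A B n / T.corr I I n) atTop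
      (𝓝 ((E.card * F.card : ℝ) / D.card ^ 2)) := by
  have hp : (D.card : ℝ) ≠ 0 := by exact_mod_cast hDne.card_ne_zero
  have hpair : ∀ i j, Tendsto (fun n => (T.corr (c.level i) (c.level j) n -
      T.corr c.base c.base n) / T.corr I I n) atTop (𝓝 0) := fun i j => by
    refine squeeze_zero_norm' (a := fun n => ((j + i) * μ.real c.base) / T.corr I I n) ?_
      (hlim.const_div_atTop _)
    refine Eventually.of_forall fun n => ?_
    rw [norm_div, Real.norm_eq_abs, Real.norm_eq_abs, abs_of_nonneg (T.corr_nonneg I I n)]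
    exact div_le_div_of_nonneg_right
      (T.abs_corr_image_image_sub_corr_le c.measurableSet_base hfin n i j) (T.corr_nonneg I I n)
  have hunion : ∀ {E F : Finset ℕ} {A B : Set X}, (∀ i ∈ E, i < c.height) →
      (∀ i ∈ F, i < c.height) → MeasurableSet B → μ B ≠ ⊤ →
      A =ᵐ[μ] (⋃ i ∈ E, c.level i : Set X) → B =ᵐ[μ] (⋃ i ∈ F, c.level i : Set X) →
      Tendsto (fun n => T.corr A B n / T.corr I I n -
        (E.card * F.card) * (T.corr c.base c.base n / T.corr I I n)) atTop (𝓝 0) := by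
    intro E F A B hE hF hBm hBfin hA hB
    have h := tendsto_finsetSum (E ×ˢ F) fun p _ => hpair p.1 p.2
    rw [Finset.sum_const_zero] at h
    refine h.congr fun n => ?_
    rw [c.corr_eq_sum_levels hE hF hfin hBm hBfin hA hB, ← Finset.sum_product',
      ← Finset.sum_div, Finset.sum_sub_distrib, Finset.sum_const, Finset.card_product, nsmul_eq_mul]
    push_cast
    ring
  have hbase : Tendsto (fun n => T.corr c.base c.base n / T.corr I I n) atTop
      (𝓝 (1 / (D.card : ℝ) ^ 2)) := by
    -- For the pair (I, I) the first ratio is eventually 1, so `hunion` reads 1 - |D|²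
    -- S_n(B,B)/S_n(I,I) → 0, with B the base.
    have h := ((hunion hD hD hIm hIfin hI hI).const_sub 1).div_const ((D.card : ℝ) ^ 2)
    rw [sub_zero] at h
    refine h.congr' ?_
    filter_upwards [hlim.eventually_gt_atTop 0] with n hn
    rw [div_self hn.ne']
    field_simp
    ring
  have h := (hunion hE hF hBm hBfin hA hB).add (hbase.const_mul (E.card * F.card : ℝ))
  rw [zero_add, mul_one_div] at h
  exact h.congr fun n => by ring

end RokhlinColumn

/-! ### The levels that make up I in a cutting-and-stacking construction. -/

namespace CuttingAndStacking

variable {X : Type*} [MeasurableSpace X] {μ : Measure X} {T : InvertibleMP μ}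
  (C : CuttingAndStacking T)

/-- The height `d_{n,i}` in `C_{n+1}` of the base of the `i`-th subcolumn of `C_n`. -/
def offset (n i : ℕ) : ℕ := ∑ k ∈ Finset.range i, ((C.column n).height + C.spacers n k)

theorem offset_add_height_le (n : ℕ) {i j : ℕ} (hij : i < j) :
    C.offset n i + (C.column n).height ≤ C.offset n j := by
  have h : C.offset n (i + 1) ≤ C.offset n j :=
    Finset.sum_le_sum_of_subset (Finset.range_mono hij)
  rw [offset, Finset.sum_range_succ] at h
  rw [offset]
  omega

theorem offset_strictMono (n : ℕ) : StrictMono (C.offset n) := fun i j hij => by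
  have := C.offset_add_height_le n hij
  have := (C.column n).height_pos
  omega

theorem offset_cuts (n : ℕ) : C.offset n (C.cuts n) = (C.column (n + 1)).height :=
  (C.height_succ n).symm

theorem two_mul_height_le (n : ℕ) :
    2 * (C.column n).height ≤ (C.column (n + 1)).height := by
  have h1 := C.offset_add_height_le n (show 0 < 1 by norm_num)
  have h2 := C.offset_add_height_le n (show 1 < 2 by norm_num)
  have h3 := (C.offset_strictMono n).monotone (C.two_le_cuts n)
  rw [C.offset_cuts] at h3
  omega

theorem height_strictMono : StrictMono fun n => (C.column n).height :=
  strictMono_nat_of_lt_succ fun n => by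
    have := C.two_mul_height_le n
    have := (C.column n).height_pos
    omega

theorem measurableSet_initialLevel : MeasurableSet C.initialLevel :=
  (C.column 0).measurableSet_base

theorem level_ae_eq (n d : ℕ) : (C.column n).level d =ᵐ[μ]
    (⋃ i ∈ Finset.range (C.cuts n), (C.column (n + 1)).level (d + C.offset n i) : Set X) := by
  refine (T.image_congr_ae d (C.base_eq n)).trans (Eq.eventuallyEq ?_)
  rw [T.image_iUnion₂]
  exact Set.iUnion₂_congr fun i _ => (C.column (n + 1)).image_level d _

/-- The set `I` is a union of levels of each column, and the bottom level is one of them. -/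
theorem exists_initialLevel_ae_eq (n : ℕ) : ∃ D : Finset ℕ, 0 ∈ D ∧
    (∀ i ∈ D, i < (C.column n).height) ∧
    C.initialLevel =ᵐ[μ] (⋃ i ∈ D, (C.column n).level i : Set X) := by
  induction n with
  | zero =>
    refine ⟨{0}, by simp, by simp [C.height_zero], ?_⟩
    simp only [Finset.mem_singleton, Set.iUnion_iUnion_eq_left]
    exact ae_eq_refl _
  | succ n ih =>
    obtain ⟨D, h0, hlt, hD⟩ := ih
    refine ⟨Finset.image₂ (fun d i => d + C.offset n i) D (Finset.range (C.cuts n)), ?_, ?_, ?_⟩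
    · refine Finset.mem_image₂.2
        ⟨0, h0, 0, Finset.mem_range.2 (by have := C.two_le_cuts n; omega), ?_⟩
      simp [offset]
    · intro j hj
      obtain ⟨d, hd, i, hi, rfl⟩ := Finset.mem_image₂.1 hj
      have h1 := C.offset_add_height_le n (Finset.mem_range.1 hi)
      have h2 := hlt d hd
      rw [C.offset_cuts] at h1
      omega
    · refine hD.trans ((Finset.eventuallyEq_iUnion D fun d _ => C.level_ae_eq n d).trans ?_)
      refine Eq.eventuallyEq (Set.ext fun x => ?_)
      simp only [Set.mem_iUnion, Finset.mem_image₂, exists_prop]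
      constructor
      · rintro ⟨d, hd, i, hi, hx⟩
        exact ⟨_, ⟨d, hd, i, hi, rfl⟩, hx⟩
      · rintro ⟨_, ⟨d, hd, i, hi, rfl⟩, hx⟩
        exact ⟨d, hd, i, hi, hx⟩

/-- The heights of the levels of `C_n` that make up `I`. -/
noncomputable def descendants (n : ℕ) : Finset ℕ := (C.exists_initialLevel_ae_eq n).choose

theorem zero_mem_descendants (n : ℕ) : 0 ∈ C.descendants n :=
  (C.exists_initialLevel_ae_eq n).choose_spec.1

theorem lt_height_of_mem_descendants (n : ℕ) : ∀ i ∈ C.descendants n, i < (C.column n).height :=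
  (C.exists_initialLevel_ae_eq n).choose_spec.2.1

theorem initialLevel_ae_eq (n : ℕ) :
    C.initialLevel =ᵐ[μ] (⋃ i ∈ C.descendants n, (C.column n).level i : Set X) :=
  (C.exists_initialLevel_ae_eq n).choose_spec.2.2

/-- A column may a priori have a base of infinite measure. Finiteness of the bases is inherited from
I, which is why the bottom level is tracked among the descendants. -/
theorem base_ae_le_initialLevel (n : ℕ) : (C.column n).base ≤ᵐ[μ] C.initialLevel :=
  (LE.le.eventuallyLE (Set.subset_biUnion_of_mem (u := (C.column n).level)
    (C.zero_mem_descendants n))).trans (C.initialLevel_ae_eq n).symm.le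

theorem measure_initialLevel_ne_top : μ C.initialLevel ≠ ⊤ := C.measure_base_zero_lt_top.ne

theorem measure_base_ne_top (n : ℕ) : μ (C.column n).base ≠ ⊤ :=
  ((measure_mono_ae (C.base_ae_le_initialLevel n)).trans_lt C.measure_base_zero_lt_top).ne

theorem measureReal_initialLevel_pos : 0 < μ.real C.initialLevel :=
  ENNReal.toReal_pos C.measure_base_zero_pos.ne' C.measure_initialLevel_ne_top

theorem card_descendants_mul (n : ℕ) :
    (C.descendants n).card * μ.real (C.column n).base = μ.real C.initialLevel :=
  ((C.column n).measureReal_of_ae_eq_levels (C.lt_height_of_mem_descendants n)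
    (C.measure_base_ne_top n) (C.initialLevel_ae_eq n)).symm

theorem measureReal_base_pos (n : ℕ) : 0 < μ.real (C.column n).base := by
  refine lt_of_le_of_ne measureReal_nonneg fun h => ?_
  have := C.card_descendants_mul n
  rw [← h, mul_zero] at this
  exact C.measureReal_initialLevel_pos.ne this

theorem measureReal_base_eq (n : ℕ) :
    μ.real (C.column n).base = C.cuts n * μ.real (C.column (n + 1)).base := by
  have hlt : ∀ i ∈ (Finset.range (C.cuts n)).image (C.offset n),
      i < (C.column (n + 1)).height := fun i hi => by
    obtain ⟨k, hk, rfl⟩ := Finset.mem_image.1 hi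
    rw [← C.offset_cuts]
    exact C.offset_strictMono n (Finset.mem_range.1 hk)
  rw [(C.column (n + 1)).measureReal_of_ae_eq_levels hlt (C.measure_base_ne_top _),
    Finset.card_image_of_injective _ (C.offset_strictMono n).injective, Finset.card_range]
  rw [Finset.set_biUnion_finset_image]
  exact C.base_eq n

/-- Both columns decompose the same measure μ(I), and the base measure is divided by r_n. Comparing
measures avoids any explicit description of the chosen index sets. -/
theorem card_descendants_succ (n : ℕ) :
    (C.descendants (n + 1)).card = C.cuts n * (C.descendants n).card := by
  have h := (C.card_descendants_mul (n + 1)).trans (C.card_descendants_mul n).symm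
  rw [C.measureReal_base_eq n, ← mul_assoc] at h
  have := mul_right_cancel₀ (C.measureReal_base_pos (n + 1)).ne' h
  rw [mul_comm]
  exact_mod_cast this

theorem card_descendants_strictMono : StrictMono fun n => (C.descendants n).card :=
  strictMono_nat_of_lt_succ fun n => by
    have h1 := C.card_descendants_succ n
    have h2 := C.two_le_cuts n
    have h3 := Finset.card_pos.2 ⟨0, C.zero_mem_descendants n⟩
    nlinarith

/-! ### Growth of the correlation sums and the uniform bound. -/

theorem card_descendants_mul_le_corr (m : ℕ) {n : ℕ} (hn : (C.column m).height ≤ n) :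
    (C.descendants m).card * μ.real C.initialLevel ≤
      2 * T.corr C.initialLevel C.initialLevel n := by
  refine le_of_eq_of_le ?_ ((C.column m).card_sq_mul_le_corr (C.lt_height_of_mem_descendants m)
    (C.initialLevel_ae_eq m) C.measurableSet_initialLevel (C.measure_base_ne_top m)
    C.measure_initialLevel_ne_top hn)
  rw [← C.card_descendants_mul m]
  ring

theorem tendsto_corr_initialLevel :
    Tendsto (T.corr C.initialLevel C.initialLevel) atTop atTop := by
  have hlim : Tendsto (fun m => ((C.descendants m).card : ℝ) * (μ.real C.initialLevel / 2))
      atTop atTop :=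
    (tendsto_natCast_atTop_atTop.comp C.card_descendants_strictMono.tendsto_atTop).atTop_mul_const
      (half_pos C.measureReal_initialLevel_pos)
  rw [tendsto_atTop]
  intro b
  obtain ⟨m, hm⟩ := (hlim.eventually_ge_atTop b).exists
  filter_upwards [eventually_ge_atTop (C.column m).height] with n hn
  linarith [C.card_descendants_mul_le_corr m hn]

theorem exists_height_le_lt {n : ℕ} (hn : 1 ≤ n) :
    ∃ m, (C.column m).height ≤ n ∧ n < (C.column (m + 1)).height := by
  have hex : ∃ m, n < (C.column m).height :=
    (C.height_strictMono.tendsto_atTop.eventually_gt_atTop n).exists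
  classical
  have h0 : Nat.find hex ≠ 0 := fun h => by
    have := Nat.find_spec hex
    rw [h, C.height_zero] at this
    omega
  obtain ⟨m, hm⟩ := Nat.exists_eq_succ_of_ne_zero h0
  refine ⟨m, not_lt.1 (Nat.find_min hex (by omega)), ?_⟩
  have := Nat.find_spec hex
  rwa [hm] at this

/-- Bounded rational ergodicity of a construction with a bounded number of cuts. -/
theorem corr_le_mul_corr {K : ℕ} (hK : ∀ n, C.cuts n ≤ K) {A : Set X} (hA : MeasurableSet A)
    (hAfin : μ A ≠ ⊤) {n : ℕ} (hn : 1 ≤ n) :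
    T.corr A C.initialLevel n ≤ 2 * K / μ.real C.initialLevel * μ.real A *
        T.corr C.initialLevel C.initialLevel n ∧
      T.corr C.initialLevel A n ≤ 2 * K / μ.real C.initialLevel * μ.real A *
        T.corr C.initialLevel C.initialLevel n := by
  obtain ⟨m, hm, hm'⟩ := C.exists_height_le_lt hn
  have hI := C.measureReal_initialLevel_pos
  have hlow := C.card_descendants_mul_le_corr m hm
  -- The bound on the cuts enters here: it makes the upper bound from C_{m+1} comparable with the
  -- lower bound from C_m.
  have hcard : ((C.descendants (m + 1)).card : ℝ) ≤ K * (C.descendants m).card := by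
    rw [C.card_descendants_succ]
    exact_mod_cast Nat.mul_le_mul_right _ (hK m)
  have hbound : (C.descendants (m + 1)).card * μ.real A ≤ 2 * K / μ.real C.initialLevel *
      μ.real A * T.corr C.initialLevel C.initialLevel n := by
    have h2 : ((C.descendants m).card : ℝ) ≤
        2 * T.corr C.initialLevel C.initialLevel n / μ.real C.initialLevel :=
      (le_div_iff₀ hI).2 hlow
    calc _ ≤ (K * (2 * T.corr C.initialLevel C.initialLevel n / μ.real C.initialLevel)) *
          μ.real A :=
        mul_le_mul_of_nonneg_right (hcard.trans (mul_le_mul_of_nonneg_left h2 K.cast_nonneg))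
          measureReal_nonneg
      _ = _ := by ring
  exact ⟨((C.column (m + 1)).corr_le_left (C.lt_height_of_mem_descendants _)
      (C.initialLevel_ae_eq _) hA hAfin hm'.le).trans hbound,
    ((C.column (m + 1)).corr_le_right (C.lt_height_of_mem_descendants _)
      (C.initialLevel_ae_eq _) hA hAfin hm'.le).trans hbound⟩

/-! ### Approximation by levels and convergence of the ratios. -/

/-- Traces on `I` of unions of levels are unions of levels. -/
theorem initialLevel_inter_levels_ae_eq {n : ℕ} {E : Finset ℕ}
    (hE : ∀ i ∈ E, i < (C.column n).height) :
    (C.initialLevel ∩ ⋃ i ∈ E, (C.column n).level i : Set X) =ᵐ[μ]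
      (⋃ i ∈ C.descendants n ∩ E, (C.column n).level i : Set X) := by
  refine ((C.initialLevel_ae_eq n).inter (ae_eq_refl _)).trans ?_
  -- There are countably many pairs of levels, so off one null set a point lies in at most one
  -- level.
  have hdisj : ∀ᵐ x ∂μ, ∀ i j : ℕ, i ≠ j → i < (C.column n).height → j < (C.column n).height →
      x ∉ (C.column n).level i ∩ (C.column n).level j := by
    simp only [ae_all_iff]
    exact fun i j hij hi hj => measure_eq_zero_iff_ae_notMem.1
      ((C.column n).aedisjoint_level hij hi hj)
  rw [eventuallyEq_set]
  filter_upwards [hdisj] with x hx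
  simp only [Set.mem_inter_iff, Set.mem_iUnion, Finset.mem_inter, exists_prop]
  constructor
  · rintro ⟨⟨i, hi, hxi⟩, j, hj, hxj⟩
    by_cases hij : i = j
    · exact ⟨i, ⟨hi, hij ▸ hj⟩, hxi⟩
    · exact absurd ⟨hxi, hxj⟩ (hx i j hij (C.lt_height_of_mem_descendants n i hi) (hE j hj))
  · rintro ⟨i, ⟨hi, hi'⟩, hxi⟩
    exact ⟨⟨i, hi, hxi⟩, i, hi', hxi⟩

/-- A measurable subset of `I` is approximated by unions of levels lying in `I`. -/
theorem exists_levels_approx {A : Set X} (hA : MeasurableSet A) (hAI : A ⊆ C.initialLevel)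
    {δ : ℝ} (hδ : 0 < δ) : ∃ N, ∀ n ≥ N, ∃ (E : Finset ℕ) (A' : Set X),
      (∀ i ∈ E, i < (C.column n).height) ∧ MeasurableSet A' ∧ A' ⊆ C.initialLevel ∧
      A' =ᵐ[μ] (⋃ i ∈ E, (C.column n).level i : Set X) ∧ μ.real (symmDiff A A') ≤ δ := by
  obtain ⟨N, hN⟩ := C.converges A hA
    ((measure_mono hAI).trans_lt C.measure_base_zero_lt_top) δ hδ
  refine ⟨N, fun n hn => ?_⟩
  obtain ⟨E, hE, hlt⟩ := hN n hn
  refine ⟨C.descendants n ∩ E, C.initialLevel ∩ ⋃ i ∈ E, (C.column n).level i,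
    fun i hi => hE i (Finset.mem_inter.1 hi).2,
    C.measurableSet_initialLevel.inter
      (E.measurableSet_biUnion fun i _ => (C.column n).measurableSet_level i),
    Set.inter_subset_left, C.initialLevel_inter_levels_ae_eq hE, ?_⟩
  refine ENNReal.toReal_le_of_le_ofReal hδ.le ((measure_mono ?_).trans hlt.le)
  intro x hx
  have hxI : x ∈ A → x ∈ C.initialLevel := fun h => hAI h
  change x ∈ symmDiff A (⋃ i ∈ E, (C.column n).level i)
  simp only [Set.mem_symmDiff, Set.mem_inter_iff] at hx ⊢
  tauto

theorem tendsto_corr_div_corr {K : ℕ} (hK : ∀ n, C.cuts n ≤ K) {A B : Set X}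
    (hA : MeasurableSet A) (hB : MeasurableSet B) (hAI : A ⊆ C.initialLevel)
    (hBI : B ⊆ C.initialLevel) :
    Tendsto (fun n => T.corr A B n / T.corr C.initialLevel C.initialLevel n) atTop
      (𝓝 (μ.real A * μ.real B / μ.real C.initialLevel ^ 2)) := by
  set I := C.initialLevel with hIdef
  have hIpos : 0 < μ.real I := C.measureReal_initialLevel_pos
  have hIfin : μ I ≠ ⊤ := C.measure_initialLevel_ne_top
  have hfin : ∀ {S : Set X}, S ⊆ I → μ S ≠ ⊤ := fun h => measure_ne_top_of_subset h hIfin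
  have hlim := C.tendsto_corr_initialLevel
  set M := 2 * K / μ.real I with hM
  have hM0 : 0 ≤ M := by positivity
  rw [Metric.tendsto_atTop']
  intro ε hε
  -- Error budget: replacing A and B costs 2Mδ in the ratio and 2δ/μ(I) in the limit value. The
  -- other ε/2 is left for the convergence for unions of levels.
  obtain ⟨δ, hδ, hδε⟩ : ∃ δ : ℝ, 0 < δ ∧ (2 * M + 2 / μ.real I) * δ < ε / 2 := by
    refine ⟨ε / 2 / (2 * M + 2 / μ.real I + 1), by positivity, ?_⟩
    rw [← mul_div_assoc, div_lt_iff₀ (by positivity)]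
    nlinarith
  obtain ⟨N₁, hN₁⟩ := C.exists_levels_approx hA hAI hδ
  obtain ⟨N₂, hN₂⟩ := C.exists_levels_approx hB hBI hδ
  -- Both approximations are taken at the same stage, so that A' and B' are unions of levels of one
  -- column.
  obtain ⟨E, A', hE, hAm', hAI', hAE, hAδ⟩ := hN₁ (max N₁ N₂) (le_max_left _ _)
  obtain ⟨F, B', hF, hBm', hBI', hBF, hBδ⟩ := hN₂ (max N₁ N₂) (le_max_right _ _)
  set m := max N₁ N₂
  have hlev := (C.column m).tendsto_corr_div_corr (C.lt_height_of_mem_descendants m)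
    ⟨0, C.zero_mem_descendants m⟩ (C.initialLevel_ae_eq m) C.measurableSet_initialLevel
    (C.measure_base_ne_top m) hIfin hlim hE hF hBm' (hfin hBI') hAE hBF
  have hvalue : (E.card * F.card : ℝ) / (C.descendants m).card ^ 2 =
      μ.real A' * μ.real B' / μ.real I ^ 2 := by
    rw [(C.column m).measureReal_of_ae_eq_levels hE (C.measure_base_ne_top m) hAE,
      (C.column m).measureReal_of_ae_eq_levels hF (C.measure_base_ne_top m) hBF,
      hIdef, ← C.card_descendants_mul m]
    have h1 := (C.measureReal_base_pos m).ne'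
    have h2 : ((C.descendants m).card : ℝ) ≠ 0 := by
      exact_mod_cast Finset.card_ne_zero_of_mem (C.zero_mem_descendants m)
    field_simp
  rw [hvalue] at hlev
  have hdiff : ∀ {S S' : Set X}, MeasurableSet S → MeasurableSet S' → S ⊆ I → S' ⊆ I →
      μ.real (symmDiff S S') ≤ δ → |μ.real S - μ.real S'| ≤ δ := fun hS hS' hSI hSI' h =>
    (abs_measureReal_sub_le_measureReal_symmDiff' hS.nullMeasurableSet hS'.nullMeasurableSet
      (hfin hSI) (hfin hSI')).trans h
  have hprod : |μ.real A' * μ.real B' / μ.real I ^ 2 - μ.real A * μ.real B / μ.real I ^ 2| ≤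
      2 / μ.real I * δ := by
    have hA1 := hdiff hA hAm' hAI hAI' hAδ
    have hB1 := hdiff hB hBm' hBI hBI' hBδ
    rw [abs_sub_comm] at hA1 hB1
    have hAle : μ.real A ≤ μ.real I := measureReal_mono hAI hIfin
    have hBle : μ.real B' ≤ μ.real I := measureReal_mono hBI' hIfin
    have hnum : |μ.real A' * μ.real B' - μ.real A * μ.real B| ≤ 2 * μ.real I * δ := by
      have : μ.real A' * μ.real B' - μ.real A * μ.real B =
        (μ.real A' - μ.real A) * μ.real B' + μ.real A * (μ.real B' - μ.real B) := by ring
      rw [this]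
      refine (abs_add_le _ _).trans ?_
      rw [abs_mul, abs_mul, abs_of_nonneg (measureReal_nonneg (s := B')),
        abs_of_nonneg (measureReal_nonneg (s := A))]
      have h1 := mul_le_mul hA1 hBle measureReal_nonneg hδ.le
      have h2 := mul_le_mul hAle hB1 (abs_nonneg _) hIpos.le
      linarith
    rw [← sub_div, abs_div, abs_of_pos (pow_pos hIpos 2), div_le_iff₀ (pow_pos hIpos 2)]
    refine hnum.trans_eq ?_
    field_simp
  have hev : ∀ᶠ n in atTop, dist (T.corr A B n / T.corr I I n)
      (μ.real A * μ.real B / μ.real I ^ 2) < ε := by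
    filter_upwards [hlim.eventually_gt_atTop 0, eventually_ge_atTop 1,
      Metric.tendsto_nhds.1 hlev (ε / 2) (half_pos hε)] with n hpos hn hclose
    rw [Real.dist_eq] at hclose ⊢
    have hsym : ∀ {S S' : Set X}, S ⊆ I → S' ⊆ I → μ (symmDiff S S') ≠ ⊤ := fun hS hS' =>
      hfin (Set.symmDiff_subset_union.trans (Set.union_subset hS hS'))
    have h1 := (C.corr_le_mul_corr hK (hA.symmDiff hAm') (hsym hAI hAI') hn).1
    have h2 := (C.corr_le_mul_corr hK (hB.symmDiff hBm') (hsym hBI hBI') hn).2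
    have h3 := T.abs_corr_sub_corr_le hIfin hAI hAI' hBI hBI' hA hAm' hB hBm' n
    -- The uniform bound applied to the two symmetric differences gives Mδ for each, for every n
    -- with n ≥ 1 and S_n(I,I) > 0, at the fixed stage m.
    have h4 : |T.corr A B n / T.corr I I n - T.corr A' B' n / T.corr I I n| ≤ 2 * M * δ := by
      rw [← sub_div, abs_div, abs_of_pos hpos, div_le_iff₀ hpos]
      have h5 := mul_le_mul_of_nonneg_right (mul_le_mul_of_nonneg_left hAδ hM0) hpos.le
      have h6 := mul_le_mul_of_nonneg_right (mul_le_mul_of_nonneg_left hBδ hM0) hpos.le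
      linarith
    have h7 := abs_sub_le (T.corr A B n / T.corr I I n) (T.corr A' B' n / T.corr I I n)
      (μ.real A * μ.real B / μ.real I ^ 2)
    have h8 := abs_sub_le (T.corr A' B' n / T.corr I I n) (μ.real A' * μ.real B' / μ.real I ^ 2)
      (μ.real A * μ.real B / μ.real I ^ 2)
    linarith
  obtain ⟨N, hN⟩ := eventually_atTop.1 hev
  exact ⟨N, fun n hn => hN n hn.le⟩

/-! ### Sweeping out and conclusion. -/

theorem level_ae_le_iUnion_image (n i : ℕ) :
    (C.column n).level i ≤ᵐ[μ] (⋃ k : ℕ, T.image k C.initialLevel : Set X) :=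
  (T.image_mono_ae i (C.base_ae_le_initialLevel n)).trans
    (Set.subset_iUnion (fun k => T.image k C.initialLevel) i).eventuallyLE

/-- Every level lies in U modulo μ, so a set A outside U is disjoint modulo μ from every union of
levels and cannot be approximated to within μ(A) unless it is null. By σ-finiteness it suffices to
treat A of finite measure. -/
theorem sweepsOut [SigmaFinite μ] : T.SweepsOut C.initialLevel := by
  set U : Set X := ⋃ k : ℕ, T.image k C.initialLevel with hU
  have hUm : MeasurableSet U :=
    MeasurableSet.iUnion fun k => T.measurableSet_image k C.measurableSet_initialLevel
  have hzero : ∀ A : Set X, MeasurableSet A → μ A < ⊤ → A ⊆ Uᶜ → μ A = 0 := by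
    intro A hA hAfin hAU
    by_contra hne
    obtain ⟨N, hN⟩ := C.converges A hA hAfin (μ A).toReal (ENNReal.toReal_pos hne hAfin.ne)
    obtain ⟨E, -, hlt⟩ := hN N le_rfl
    rw [ENNReal.ofReal_toReal hAfin.ne] at hlt
    refine hlt.not_ge (measure_mono_ae ?_)
    have hle : ∀ᵐ x ∂μ, ∀ i, x ∈ (C.column N).level i → x ∈ U :=
      ae_all_iff.2 fun i => C.level_ae_le_iUnion_image N i
    filter_upwards [hle] with x hx hxA
    refine Or.inl ⟨hxA, fun hxE => ?_⟩
    obtain ⟨i, -, hxi⟩ := Set.mem_iUnion₂.1 hxE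
    exact hAU hxA (hx i hxi)
  change μ Uᶜ = 0
  by_contra hne
  obtain ⟨A, hA, hAU, hApos, hAfin⟩ :=
    Measure.exists_subset_measure_lt_top hUm.compl (pos_iff_ne_zero.2 hne)
  exact hApos.ne' (hzero A hA hAfin hAU)

theorem isWeaklyRationallyErgodicOn [SigmaFinite μ] (hC : C.HasBoundedCuts) :
    T.IsWeaklyRationallyErgodicOn C.initialLevel where
  measurableSet := C.measurableSet_initialLevel
  measure_pos := C.measure_base_zero_pos
  measure_lt_top := C.measure_base_zero_lt_top
  sweepsOut := C.sweepsOut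
  tendsto A B hA hB hAI hBI := by
    obtain ⟨K, hK⟩ := hC
    have hI := C.measureReal_initialLevel_pos.ne'
    -- The factor μ(I)² comes from the normalization a_n(I) = S_n(I,I)/μ(I)².
    have h := (C.tendsto_corr_div_corr hK hA hB hAI hBI).mul_const (μ.real C.initialLevel ^ 2)
    rw [div_mul_cancel₀ _ (pow_ne_zero 2 hI)] at h
    refine h.congr fun n => ?_
    rw [T.weightSum_eq, one_div_div, InvertibleMP.corr]
    ring

end CuttingAndStacking

theorem mainTheorem4 {X : Type*} [MeasurableSpace X] [StandardBorelSpace X] (μ : Measure X)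
    [SigmaFinite μ] [NullSingletonClass μ] (T : InvertibleMP μ) (C : CuttingAndStacking T)
    (hC : C.HasBoundedCuts) :
    T.IsWeaklyRationallyErgodic ∧ T.IsWeaklyRationallyErgodicOn C.initialLevel :=
  ⟨⟨_, C.isWeaklyRationallyErgodicOn hC⟩, C.isWeaklyRationallyErgodicOn hC⟩
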